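/- Let $p\in(0,1/2)$ be a constant. For $\mathbf{x}=(x_1,\dots,x_n)\in\{0,1\}^n$ and an integer $k\ge 1$, let $\mathsf{TH}_k(\mathbf{x})=1$ if $\sum_{i=1}^n x_i\ge k$ and $\mathsf{TH}_k(\mathbf{x})=0$ otherwise. A variable-length algorithm on $n$ bits accesses an unknown input $\mathbf{x}\in\{0,1\}^n$ only through noisy queries: at each time step, depending on all responses received so far, it either stops and outputs a value, or queries some bit $x_i$ and receives $x_i\oplus Z$, where the noise bits $Z\sim\mathrm{Bern}(p)$ of different queries are independent. Let $M$ be the (random) total number of queries. The worst-case error probability is the maximum over $\mathbf{x}\in\{0,1\}^n$ of the probability that the algorithm does not output $\mathsf{TH}_k(\mathbf{x})$. Let $D_{\mathrm{KL}}(p\|1-p)$ be the Kullback-Leibler divergence (with natural logarithm) between $\mathrm{Bern}(p)$ and $\mathrm{Bern}(1-p)$. Let $k=k_n\ge 1$ be integers and $\delta=\delta_n>0$ be reals with $k_n=o(n)$ and $\delta_n=o(1)$ as $n\to\infty$. Then there are, for every $n$, a variable-length algorithm on $n$ bits (which may depend on $n$, $k_n$, $\delta_n$, $p$) and a sequence $\varepsilon_n\to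 0$, such that for every $n$ the algorithm computes $\mathsf{TH}_{k_n}$ with worst-case error probability at most $\delta_n$, and $$\mathbb{E}[M\mid\mathbf{x}]\le(1+\varepsilon_n)\,\frac{n\log\frac{k_n}{\delta_n}}{D_{\mathrm{KL}}(p\|1-p)}\qquad\text{for every input }\mathbf{x}\in\{0,1\}^n.$$ -/

import Mathlib

open MeasureTheory ProbabilityTheory Filter Asymptotics InformationTheory
open scoped ENNReal Topology

noncomputable section

/-- The threshold-`k` function of `n` bits: it is `true` iff at least `k` of the bits are `true`. -/
def threshold (k : ℕ) {n : ℕ} (x : Fin n → Bool) : Bool :=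
  decide (k ≤ ∑ i, (x i).toNat)

/-- A variable-length (adaptive) query algorithm on `n` bits. Given the list of all responses
received so far, in chronological order, it either queries a bit (`Sum.inl i`) or stops and
returns an output (`Sum.inr b`). There is no bound on the number of queries. The past queries need
not be recorded, because they are determined by the past responses. The algorithm has no coins of
its own: the only randomness is that of the responses. -/
abbrev QueryAlgorithm (n : ℕ) : Type := List Bool → Fin n ⊕ Bool

namespace QueryAlgorithm

variable {n : ℕ} (A : QueryAlgorithm n) (x : Fin n → Bool)

/-- The responses received in the first `t` time steps, on input `x` and noise sequence `ω`: the
response to the query of bit `i` at time `t` is `x i` if `ω t = false`, and it is the negation of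
`x i` if `ω t = true`. Once the algorithm has stopped, nothing changes any more. -/
def history (ω : ℕ → Bool) : ℕ → List Bool
  | 0 => []
  | t + 1 =>
    match A (history ω t) with
    | Sum.inl i => history ω t ++ [xor (x i) (ω t)]
    | Sum.inr _ => history ω t

/-- The run on input `x` with noise sequence `ω` stops and returns the value `b`. -/
def Returns (ω : ℕ → Bool) (b : Bool) : Prop :=
  ∃ t : ℕ, A (history A x ω t) = Sum.inr b

/-- The total number of queries made on input `x` with noise sequence `ω`, that is, the number of
time steps at which a bit is queried (`∞` if the run never stops). -/
def numQueries (ω : ℕ → Bool) : ℝ≥0∞ :=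
  ∑' t : ℕ, if (A (history A x ω t)).isLeft then 1 else 0

end QueryAlgorithm

/-- The law of the noise sequence: independent bits, each equal to `true` with probability `p`. -/
def noiseMeasure (p : unitInterval) : Measure (ℕ → Bool) :=
  Measure.infinitePi fun _ : ℕ => bernoulliMeasure true false p

namespace QueryAlgorithm

variable {n : ℕ} (A : QueryAlgorithm n)

/-- The expected number of queries on input `x`, at crossover probability `p`. -/
def expectedQueries (p : unitInterval) (x : Fin n → Bool) : ℝ≥0∞ :=
  ∫⁻ ω, numQueries A x ω ∂(noiseMeasure p)

/-- The worst-case error probability of `A` as an algorithm for computing `f`: the largest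
probability, over all inputs `x`, that `A` does not return `f x` (a run that never stops counts
as an error). -/
def worstCaseError (p : unitInterval) (f : (Fin n → Bool) → Bool) : ℝ≥0∞ :=
  ⨆ x : Fin n → Bool, noiseMeasure p {ω | ¬ Returns A x ω (f x)}

end QueryAlgorithm

/-- The Kullback-Leibler divergence between the Bernoulli distributions with parameters `p` and
`q`, in nats. -/
def klBernoulli (p q : unitInterval) : ℝ :=
  (klDiv (bernoulliMeasure true false p) (bernoulliMeasure true false q)).toReal

end

/-! Test each bit by a biased random walk with barriers `0` and `a + b`, started at `a`, and stop at
the `k`-th declared one. With `ρ = p / (1 - p)`, a zero costs about `a / (1 - 2p)` queries and is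
misjudged with probability at most `ρ ^ b`; a one costs about `b / (1 - 2p)` and is missed with
probability at most `ρ ^ a ≤ 1 / 2`. So at most `2k` ones are tested on average: the cost is at most
`(n a + 2 k b) / (1 - 2p)`, and the two kinds of error have probabilities at most `2 k ρ ^ a` and `n
ρ ^ b`. Asymmetry is the point: `a ≈ log (2k/δ) / log (1/ρ)` governs the `n` cheap tests, while `b ≈
log (n/δ) / log (1/ρ)` is paid only about `2k` times, which is negligible as `k = o(n)`. The
divergence is `(1 - 2p) log (1/ρ)`.

All three bounds are supermartingale arguments: `DominatesTests.isPotential` turns a function `G i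
c` of bit index and count into a potential on histories, and each bound is a choice of `G`. -/

instance isProbabilityMeasure_noiseMeasure (p : unitInterval) :
    IsProbabilityMeasure (noiseMeasure p) := by
  unfold noiseMeasure; infer_instance

lemma lintegral_bernoulliMeasure_bool (p : unitInterval) (g : Bool → ℝ≥0∞) :
    ∫⁻ b, g b ∂(bernoulliMeasure true false p) =
      ENNReal.ofReal p * g true + ENNReal.ofReal (1 - p) * g false := by
  rw [bernoulliMeasure_def, lintegral_add_measure, lintegral_smul_measure, lintegral_smul_measure,
    lintegral_dirac, lintegral_dirac]
  simp only [ENNReal.smul_def, smul_eq_mul]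
  congr 2
  · rw [← ENNReal.ofReal_coe_nnreal]; rfl
  · rw [← ENNReal.ofReal_coe_nnreal]; rfl

/-! ### Potentials on response histories -/

namespace QueryAlgorithm

variable {n : ℕ} (A : QueryAlgorithm n) (x : Fin n → Bool)

lemma history_congr {ω ω' : ℕ → Bool} :
    ∀ {t : ℕ}, (∀ s < t, ω s = ω' s) → history A x ω t = history A x ω' t
  | 0, _ => rfl
  | t + 1, h => by
    have ih := history_congr (t := t) fun s hs => h s (by omega)
    simp only [history, ih, h t (by omega)]

/-- Only the first `t` noise bits are read. Factoring through a finite type makes every function of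
the history measurable. -/
lemma exists_history_eq_restrict (t : ℕ) :
    ∃ F : (Finset.range t → Bool) → List Bool,
      ∀ ω, history A x ω t = F (fun i => ω i) := by
  refine ⟨fun v => history A x (fun s => if h : s ∈ Finset.range t then v ⟨s, h⟩ else false) t,
    fun ω => history_congr A x fun s hs => ?_⟩
  simp [hs]

lemma measurable_comp_history {β : Type*} [MeasurableSpace β] (g : List Bool → β) (t : ℕ) :
    Measurable fun ω => g (history A x ω t) := by
  obtain ⟨F, hF⟩ := exists_history_eq_restrict A x t
  simp only [hF]
  exact (measurable_of_countable fun v => g (F v)).comp (by fun_prop)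

/-- The noise bit of step `t` is independent of the history before it. -/
lemma lintegral_history_noise (p : unitInterval) (g : List Bool → Bool → ℝ≥0∞) (t : ℕ) :
    ∫⁻ ω, g (history A x ω t) (ω t) ∂(noiseMeasure p) =
      ∫⁻ ω, (ENNReal.ofReal p * g (history A x ω t) true +
        ENNReal.ofReal (1 - p) * g (history A x ω t) false) ∂(noiseMeasure p) := by
  obtain ⟨F, hF⟩ := exists_history_eq_restrict A x t
  simp only [hF]
  have hlaw : ∀ s : ℕ, (noiseMeasure p).map (fun ω => ω s) = bernoulliMeasure true false p :=
    fun s => (measurePreserving_eval_infinitePi (fun _ : ℕ => bernoulliMeasure true false p) s).map_eq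
  have hind : iIndepFun (fun (s : ℕ) (ω : ℕ → Bool) => ω s) (noiseMeasure p) := by
    rw [iIndepFun_iff_map_fun_eq_infinitePi_map (by fun_prop)]
    simp only [hlaw]
    exact Measure.map_id'
  have h1 : IndepFun (fun (ω : ℕ → Bool) (i : Finset.range t) => ω i)
      (fun (ω : ℕ → Bool) => ω t) (noiseMeasure p) := by
    have h2 := hind.indepFun_finset (Finset.range t) {t} (by simp) (by fun_prop)
    exact h2.comp (φ := id) (ψ := fun v : ({t} : Finset ℕ) → Bool => v ⟨t, by simp⟩)
      measurable_id (by fun_prop)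
  have hmap := h1.map_prod_eq_prod_map_map
    (by fun_prop : Measurable _).aemeasurable (by fun_prop : Measurable _).aemeasurable
  rw [hlaw] at hmap
  have hG : Measurable fun z : (Finset.range t → Bool) × Bool => g (F z.1) z.2 :=
    measurable_of_countable _
  calc ∫⁻ ω, g (F fun i => ω i) (ω t) ∂(noiseMeasure p)
      = ∫⁻ z, g (F z.1) z.2 ∂((noiseMeasure p).map
          (fun ω => ((fun i : Finset.range t => ω i), ω t))) := by
        rw [lintegral_map hG (by fun_prop)]
    _ = _ := by
        rw [hmap, lintegral_prod _ hG.aemeasurable, lintegral_map (measurable_of_countable _)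
          (by fun_prop)]
        simp only [lintegral_bernoulliMeasure_bool]

/-- A nonnegative potential which, in expectation, drops by at least `κ` at each query. -/
def IsPotential (p : unitInterval) (κ : ℝ≥0∞) (Φ : List Bool → ℝ≥0∞) : Prop :=
  ∀ h i, A h = Sum.inl i →
    κ + (ENNReal.ofReal p * Φ (h ++ [!x i]) + ENNReal.ofReal (1 - p) * Φ (h ++ [x i])) ≤ Φ h

variable {A x}

lemma IsPotential.lintegral_add_le {p : unitInterval} {κ : ℝ≥0∞} {Φ : List Bool → ℝ≥0∞}
    (hΦ : IsPotential A x p κ Φ) (t : ℕ) :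
    ∫⁻ ω, Φ (history A x ω t) ∂(noiseMeasure p) +
      κ * ∑ s ∈ Finset.range t,
        ∫⁻ ω, (if (A (history A x ω s)).isLeft then 1 else 0) ∂(noiseMeasure p) ≤ Φ [] := by
  induction t with
  | zero => simp [history]
  | succ t ih =>
    refine le_trans ?_ ih
    rw [Finset.sum_range_succ, mul_add, add_comm (κ * _) (κ * _), ← add_assoc]
    gcongr
    -- The next potential as a function of the past and one fresh noise bit, so that independence
    -- applies; stopped histories do not move.
    let g : List Bool → Bool → ℝ≥0∞ := fun h b =>
      match A h with
      | Sum.inl i => Φ (h ++ [xor (x i) b])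
      | Sum.inr _ => Φ h
    have h1 : ∀ ω, Φ (history A x ω (t + 1)) = g (history A x ω t) (ω t) := by
      intro ω
      simp only [history, g]
      split <;> simp [*]
    simp only [h1]
    rw [lintegral_history_noise A x p g t, ← lintegral_const_mul _
      (measurable_comp_history A x (fun h => if (A h).isLeft then (1 : ℝ≥0∞) else 0) t),
      ← lintegral_add_right _ ((measurable_comp_history A x
        (fun h => κ * if (A h).isLeft then (1 : ℝ≥0∞) else 0) t))]
    refine lintegral_mono fun ω => ?_
    simp only [g]
    rcases hA : A (history A x ω t) with i | b
    · have := hΦ _ i hA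
      simpa [add_comm] using this
    · simp only [Sum.isLeft_inr, Bool.false_eq_true, if_false, mul_zero, add_zero, ← add_mul]
      rw [← ENNReal.ofReal_add p.2.1 (by linarith [p.2.2])]
      simp

lemma IsPotential.expectedQueries_le {p : unitInterval} {Φ : List Bool → ℝ≥0∞}
    (hΦ : IsPotential A x p 1 Φ) : expectedQueries A p x ≤ Φ [] := by
  unfold expectedQueries numQueries
  rw [lintegral_tsum fun t => (measurable_comp_history A x
    (fun h => if (A h).isLeft then (1 : ℝ≥0∞) else 0) t).aemeasurable]
  refine ENNReal.tsum_le_of_sum_range_le fun t => ?_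
  have := hΦ.lintegral_add_le t
  rw [one_mul] at this
  exact le_trans le_add_self this

lemma history_succ_of_inr {ω : ℕ → Bool} {t : ℕ} {b : Bool}
    (h : A (history A x ω t) = Sum.inr b) : history A x ω (t + 1) = history A x ω t := by
  simp [history, h]

/-- Markov's inequality at each time `t`; stopped histories are frozen, so the events increase to
the event of returning `b`. -/
lemma IsPotential.measure_returns_le {p : unitInterval} {Φ : List Bool → ℝ≥0∞} {b : Bool}
    (hΦ : IsPotential A x p 0 Φ) (hb : ∀ h, A h = Sum.inr b → 1 ≤ Φ h) :
    noiseMeasure p {ω | Returns A x ω b} ≤ Φ [] := by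
  have hset : {ω | Returns A x ω b} = ⋃ t, {ω | A (history A x ω t) = Sum.inr b} := by
    ext ω; simp [Returns]
  have hmono : Monotone fun t => {ω | A (history A x ω t) = Sum.inr b} := by
    refine monotone_nat_of_le_succ fun t ω hω => ?_
    simp only [Set.mem_ofPred_eq] at hω ⊢
    rw [history_succ_of_inr hω, hω]
  rw [hset, hmono.measure_iUnion]
  refine iSup_le fun t => ?_
  have h1 := hΦ.lintegral_add_le t
  rw [zero_mul, add_zero] at h1
  refine le_trans ?_ h1
  have h2 := mul_meas_ge_le_lintegral (μ := noiseMeasure p) (measurable_comp_history A x Φ t) 1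
  rw [one_mul] at h2
  exact le_trans (measure_mono fun ω hω => hb _ hω) h2

/-- A finite mean forces the run to stop almost surely, and then some value is returned. -/
lemma measure_not_returns_le {p : unitInterval} (hfin : expectedQueries A p x ≠ ∞) (b : Bool) :
    noiseMeasure p {ω | ¬ Returns A x ω b} ≤ noiseMeasure p {ω | Returns A x ω (!b)} := by
  have hmeas : Measurable (numQueries A x) := by
    unfold numQueries
    exact Measurable.tsum fun t => measurable_comp_history A x
      (fun h => if (A h).isLeft then (1 : ℝ≥0∞) else 0) t
  refine measure_mono_ae ?_
  filter_upwards [ae_lt_top hmeas hfin] with ω hω hn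
  by_contra hc
  have hc' : ∀ t, (A (history A x ω t)).isLeft = true := by
    intro t
    rcases hA : A (history A x ω t) with i | d
    · rfl
    · exfalso
      have : d = b ∨ d = !b := by cases d <;> cases b <;> simp
      rcases this with rfl | rfl
      · exact hn ⟨t, hA⟩
      · exact hc ⟨t, hA⟩
  simp only [numQueries, hc', if_true] at hω
  rw [ENNReal.tsum_const_eq_top_of_ne_zero one_ne_zero] at hω
  exact lt_irrefl _ hω

end QueryAlgorithm

/-! ### The divergence in closed form -/

lemma klBernoulli_symm_eq {p : unitInterval} (hp0 : 0 < (p : ℝ)) (hp1 : (p : ℝ) < 1 / 2) :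
    klBernoulli p (unitInterval.symm p) = (1 - 2 * p) * Real.log ((1 - p) / p) := by
  set μ : Measure Bool := bernoulliMeasure true false p with hμ
  set ν : Measure Bool := bernoulliMeasure true false (unitInterval.symm p) with hν
  have hq0 : 0 < 1 - (p : ℝ) := by linarith
  let f : Bool → ℝ≥0∞ := fun b =>
    if b then ENNReal.ofReal (p / (1 - p)) else ENNReal.ofReal ((1 - p) / p)
  have hpt : ∀ q : unitInterval, ((unitInterval.toNNReal q : NNReal) : ℝ≥0∞) =
      ENNReal.ofReal q := by
    intro q; rw [← ENNReal.ofReal_coe_nnreal]; rfl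
  have hνt : ∀ b, ν {b} = if b then ENNReal.ofReal (1 - p) else ENNReal.ofReal p := by
    intro b
    cases b <;> simp [hν, bernoulliMeasure_def, hpt, ENNReal.smul_def]
  have hμt : ∀ b, μ {b} = if b then ENNReal.ofReal p else ENNReal.ofReal (1 - p) := by
    intro b
    cases b <;> simp [hμ, bernoulliMeasure_def, hpt, ENNReal.smul_def]
  have hdens : μ = ν.withDensity f := by
    refine Measure.ext_of_singleton fun b => ?_
    rw [withDensity_apply _ (measurableSet_singleton b), lintegral_singleton, hνt, hμt]
    cases b
    · simp only [f, Bool.false_eq_true, if_false]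
      rw [← ENNReal.ofReal_mul (by positivity)]
      congr 1; field_simp
    · simp only [f, if_true]
      rw [← ENNReal.ofReal_mul (by positivity)]
      congr 1; field_simp
  have hac : μ ≪ ν := by rw [hdens]; exact withDensity_absolutelyContinuous _ _
  -- Both atoms of `ν` have positive mass, so almost everywhere means everywhere.
  have hrn : ∀ b, μ.rnDeriv ν b = f b := by
    have h1 : μ.rnDeriv ν =ᵐ[ν] f := by
      rw [hdens]; exact Measure.rnDeriv_withDensity ν (measurable_of_countable f)
    intro b
    by_contra hb
    have h2 : ν {b} = 0 := measure_mono_null (by simpa using hb) h1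
    rw [hνt] at h2
    cases b <;> simp at h2 <;> linarith
  unfold klBernoulli
  rw [← hμ, ← hν, toReal_klDiv_of_measure_eq hac (by simp [hμ, hν])]
  rw [integral_fintype .of_finite]
  have hr : ∀ b, μ.real {b} = if b then (p : ℝ) else 1 - p := by
    intro b
    rw [measureReal_def, hμt]
    cases b
    · simp [hq0.le]
    · simp [hp0.le]
  simp only [llr, hrn, Fintype.sum_bool, hr, f, if_true, Bool.false_eq_true, if_false, smul_eq_mul]
  rw [ENNReal.toReal_ofReal (by positivity), ENNReal.toReal_ofReal (by positivity),
    Real.log_div hp0.ne' hq0.ne', Real.log_div hq0.ne' hp0.ne']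
  ring

/-! ### The scanning algorithm -/

/-- The state of a scan through the bits: the bit being tested, the number of bits declared to be
`true` so far, and the position of the random walk of the current test. -/
structure ScanState where
  bit : ℕ
  count : ℕ
  walk : ℕ

namespace ScanState

/-- The walk of a test starts at `a`. Reaching `0` declares the bit `false`, and reaching `a + b`
declares it `true`. -/
def next (a b : ℕ) (s : ScanState) (r : Bool) : ScanState :=
  if r then
    if s.walk + 1 = a + b then ⟨s.bit + 1, s.count + 1, a⟩ else ⟨s.bit, s.count, s.walk + 1⟩
  else
    if s.walk ≤ 1 then ⟨s.bit + 1, s.count, a⟩ else ⟨s.bit, s.count, s.walk - 1⟩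

/-- The state of the scan after the responses `h`. -/
def ofResponses (a b : ℕ) (h : List Bool) : ScanState :=
  h.foldl (next a b) ⟨0, 0, a⟩

lemma ofResponses_append (a b : ℕ) (h : List Bool) (r : Bool) :
    ofResponses a b (h ++ [r]) = next a b (ofResponses a b h) r := by
  simp [ofResponses]

/-- A walk that hits a barrier is reset to `a` at once, so barrier positions are never stored. -/
lemma walk_ofResponses_mem {a b : ℕ} (ha : 1 ≤ a) (hb : 1 ≤ b) (h : List Bool) :
    1 ≤ (ofResponses a b h).walk ∧ (ofResponses a b h).walk < a + b := by
  induction h using List.reverseRecOn with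
  | nil => simp [ofResponses]; omega
  | append_singleton h r ih =>
    rw [ofResponses_append]
    unfold next
    split_ifs <;> simp <;> omega

end ScanState

open ScanState

/-- Test the bits one after another by sequential probability ratio tests, and stop as soon as `k`
bits have been declared to be `true`. -/
def thresholdScan (n k a b : ℕ) : QueryAlgorithm n := fun h =>
  if k ≤ (ofResponses a b h).count then Sum.inr true
  else if hi : (ofResponses a b h).bit < n then Sum.inl ⟨_, hi⟩
  else Sum.inr false

lemma thresholdScan_eq_inl {n k a b : ℕ} {h : List Bool} {i : Fin n}
    (hA : thresholdScan n k a b h = Sum.inl i) :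
    (ofResponses a b h).count < k ∧ (ofResponses a b h).bit = i := by
  unfold thresholdScan at hA
  split_ifs at hA with h1 h2
  simp only [Sum.inl.injEq] at hA
  exact ⟨by omega, by rw [← hA]⟩

lemma thresholdScan_eq_inr_true {n k a b : ℕ} {h : List Bool}
    (hA : thresholdScan n k a b h = Sum.inr true) : k ≤ (ofResponses a b h).count := by
  unfold thresholdScan at hA
  split_ifs at hA with h1 h2
  · exact h1
  · simp at hA

lemma thresholdScan_eq_inr_false {n k a b : ℕ} {h : List Bool}
    (hA : thresholdScan n k a b h = Sum.inr false) :
    (ofResponses a b h).count < k ∧ n ≤ (ofResponses a b h).bit := by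
  unfold thresholdScan at hA
  split_ifs at hA with h1 h2
  · simp at hA
  · exact ⟨by omega, by omega⟩

/-! ### Potential of a single test -/

/-- The expected value of `κ` times the remaining duration of a test of a bit `y`, plus `F₀` if it
declares `false` or `F₁` if it declares `true`, bounded as a function of the position `u`. -/
noncomputable def walkPotential (p κ : ℝ) (a b : ℕ) (y : Bool) (F₀ F₁ : ℝ) (u : ℕ) : ℝ :=
  if y then κ * ((a + b - u : ℕ) : ℝ) / (1 - 2 * p) + F₁ + (p / (1 - p)) ^ u * max (F₀ - F₁) 0
  else κ * u / (1 - 2 * p) + F₀ + (p / (1 - p)) ^ (a + b - u) * max (F₁ - F₀) 0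

section walkPotential

variable {p κ : ℝ} {a b : ℕ} {y : Bool} {F₀ F₁ : ℝ}

lemma walkPotential_nonneg (hp0 : 0 < p) (hp1 : p < 1 / 2) (hκ : 0 ≤ κ) (h₀ : 0 ≤ F₀)
    (h₁ : 0 ≤ F₁) (u : ℕ) : 0 ≤ walkPotential p κ a b y F₀ F₁ u := by
  have h2 : 0 < 1 - 2 * p := by linarith
  have h3 : 0 < 1 - p := by linarith
  unfold walkPotential
  split_ifs <;> positivity

/-- Truncating the difference of the final values at `0` gives domination at both barriers,
whichever outcome has the larger value. -/
lemma le_walkPotential_zero (hp0 : 0 < p) (hp1 : p < 1 / 2) (hκ : 0 ≤ κ) :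
    F₀ ≤ walkPotential p κ a b y F₀ F₁ 0 := by
  have h2 : 0 < 1 - 2 * p := by linarith
  have h3 : 0 < 1 - p := by linarith
  unfold walkPotential
  split_ifs
  · have h4 : 0 ≤ κ * ((a + b - 0 : ℕ) : ℝ) / (1 - 2 * p) := by positivity
    have h5 := le_max_left (F₀ - F₁) 0
    simp only [pow_zero, one_mul]
    linarith
  · have h4 : 0 ≤ (p / (1 - p)) ^ (a + b - 0) * max (F₁ - F₀) 0 := by positivity
    simp only [Nat.cast_zero, mul_zero, zero_div, zero_add]
    linarith

lemma le_walkPotential_top (hp0 : 0 < p) (hp1 : p < 1 / 2) (hκ : 0 ≤ κ) :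
    F₁ ≤ walkPotential p κ a b y F₀ F₁ (a + b) := by
  have h2 : 0 < 1 - 2 * p := by linarith
  have h3 : 0 < 1 - p := by linarith
  unfold walkPotential
  split_ifs
  · have h4 : 0 ≤ (p / (1 - p)) ^ (a + b) * max (F₀ - F₁) 0 := by positivity
    simp only [Nat.sub_self, Nat.cast_zero, mul_zero, zero_div, zero_add]
    linarith
  · have h4 : 0 ≤ κ * ((a + b : ℕ) : ℝ) / (1 - 2 * p) := by positivity
    have h5 := le_max_left (F₁ - F₀) 0
    simp only [Nat.sub_self, pow_zero, one_mul]
    linarith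

/-- The linear term loses `κ` per step because the drift towards the correct barrier is `1 - 2p`.
The power of `ρ = p / (1 - p)`, with exponent the distance to the wrong barrier, is harmonic because
`p + (1 - p) ρ² = ρ`. -/
lemma walkPotential_step (hp1 : p < 1 / 2) {u : ℕ} (hu : 1 ≤ u) (hu' : u < a + b) :
    κ + (p * walkPotential p κ a b y F₀ F₁ (if y then u - 1 else u + 1) +
      (1 - p) * walkPotential p κ a b y F₀ F₁ (if y then u + 1 else u - 1)) =
      walkPotential p κ a b y F₀ F₁ u := by
  have h2 : 1 - 2 * p ≠ 0 := by linarith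
  have h3 : 1 - p ≠ 0 := by linarith
  have hr : p + (1 - p) * (p / (1 - p)) ^ 2 = p / (1 - p) := by field_simp; ring
  -- Interior positions: these substitutions remove every truncated subtraction.
  obtain ⟨v, rfl⟩ : ∃ v, u = v + 1 := ⟨u - 1, by omega⟩
  obtain ⟨w, hw⟩ : ∃ w, a + b = v + 1 + (w + 1) := ⟨a + b - (v + 1) - 1, by omega⟩
  generalize hρ : p / (1 - p) = ρ at hr
  cases y
  · simp only [walkPotential, hw, Bool.false_eq_true, if_false, hρ,
      show v + 1 + (w + 1) - (v + 1 + 1) = w by omega, show v + 1 + (w + 1) - (v + 1) = w + 1 by omega,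
      show v + 1 - 1 = v by omega, show v + 1 + (w + 1) - v = w + 2 by omega]
    generalize max (F₁ - F₀) 0 = D
    have : ρ ^ (w + 1) * D = ρ ^ w * D * (p + (1 - p) * ρ ^ 2) := by rw [hr]; ring
    rw [this]
    push_cast
    linear_combination -κ * mul_inv_cancel₀ h2
  · simp only [walkPotential, hw, if_true, hρ,
      show v + 1 + (w + 1) - (v + 1 + 1) = w by omega, show v + 1 + (w + 1) - (v + 1) = w + 1 by omega,
      show v + 1 - 1 = v by omega, show v + 1 + (w + 1) - v = w + 2 by omega]
    generalize max (F₀ - F₁) 0 = D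
    have : ρ ^ (v + 1) * D = ρ ^ v * D * (p + (1 - p) * ρ ^ 2) := by rw [hr]; ring
    rw [this]
    push_cast
    linear_combination -κ * mul_inv_cancel₀ h2

end walkPotential

/-! ### Gluing the tests together -/

/-- The potential of a state of the scan which has the value `G i c` when the test of bit `i` is
due to start with `c` bits declared to be `true`. -/
noncomputable def scanPotential {n : ℕ} (k a b : ℕ) (x : Fin n → Bool) (p κ : ℝ) (G : ℕ → ℕ → ℝ)
    (s : ScanState) : ℝ :=
  if h : s.count < k ∧ s.bit < n then
    walkPotential p κ a b (x ⟨s.bit, h.2⟩) (G (s.bit + 1) s.count) (G (s.bit + 1) (s.count + 1))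
      s.walk
  else G s.bit s.count

/-- The potential `G` at the start of each test dominates the potential of the test. -/
def DominatesTests {n : ℕ} (k a b : ℕ) (x : Fin n → Bool) (p κ : ℝ) (G : ℕ → ℕ → ℝ) : Prop :=
  ∀ (i : Fin n) (c : ℕ), c < k →
    walkPotential p κ a b (x i) (G (i + 1) c) (G (i + 1) (c + 1)) a ≤ G i c

lemma DominatesTests.scanPotential_le {n k a b : ℕ} {x : Fin n → Bool} {p κ : ℝ}
    {G : ℕ → ℕ → ℝ} (hG : DominatesTests k a b x p κ G) (i c : ℕ) :
    scanPotential k a b x p κ G ⟨i, c, a⟩ ≤ G i c := by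
  unfold scanPotential
  split_ifs with h
  · exact hG ⟨i, h.2⟩ c h.1
  · exact le_rfl

lemma DominatesTests.scanPotential_next_true_le {n k a b : ℕ} {x : Fin n → Bool} {p κ : ℝ}
    {G : ℕ → ℕ → ℝ} (hG : DominatesTests k a b x p κ G) (hp0 : 0 < p) (hp1 : p < 1 / 2)
    (hκ : 0 ≤ κ) (i : Fin n) {c u : ℕ} (hc : c < k) :
    scanPotential k a b x p κ G (next a b ⟨i, c, u⟩ true) ≤
      walkPotential p κ a b (x i) (G (i + 1) c) (G (i + 1) (c + 1)) (u + 1) := by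
  simp only [next, if_true]
  split_ifs with h
  · rw [h]
    exact (hG.scanPotential_le _ _).trans (le_walkPotential_top hp0 hp1 hκ)
  · simp [scanPotential, hc]

lemma DominatesTests.scanPotential_next_false_le {n k a b : ℕ} {x : Fin n → Bool} {p κ : ℝ}
    {G : ℕ → ℕ → ℝ} (hG : DominatesTests k a b x p κ G) (hp0 : 0 < p) (hp1 : p < 1 / 2)
    (hκ : 0 ≤ κ) (i : Fin n) {c u : ℕ} (hc : c < k) :
    scanPotential k a b x p κ G (next a b ⟨i, c, u⟩ false) ≤
      walkPotential p κ a b (x i) (G (i + 1) c) (G (i + 1) (c + 1)) (u - 1) := by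
  simp only [next, Bool.false_eq_true, if_false]
  split_ifs with h
  · rw [Nat.sub_eq_zero_of_le h]
    exact (hG.scanPotential_le _ _).trans (le_walkPotential_zero hp0 hp1 hκ)
  · simp [scanPotential, hc]

lemma scanPotential_nonneg {n k a b : ℕ} {x : Fin n → Bool} {p κ : ℝ} {G : ℕ → ℕ → ℝ}
    (hG0 : ∀ i c, 0 ≤ G i c) (hp0 : 0 < p) (hp1 : p < 1 / 2) (hκ : 0 ≤ κ) (s : ScanState) :
    0 ≤ scanPotential k a b x p κ G s := by
  unfold scanPotential
  split_ifs
  · exact walkPotential_nonneg hp0 hp1 hκ (hG0 _ _) (hG0 _ _) _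
  · exact hG0 _ _

/-- Inside a test the drift is exactly `κ`; the potential can only drop further when a barrier is
hit and the next test starts. -/
lemma DominatesTests.isPotential {n k a b : ℕ} {x : Fin n → Bool} {p : unitInterval} {κ : ℝ}
    {G : ℕ → ℕ → ℝ} (hG : DominatesTests k a b x p κ G) (hG0 : ∀ i c, 0 ≤ G i c)
    (hp0 : 0 < (p : ℝ)) (hp1 : (p : ℝ) < 1 / 2) (hκ : 0 ≤ κ) (ha : 1 ≤ a) (hb : 1 ≤ b) :
    (thresholdScan n k a b).IsPotential x p (ENNReal.ofReal κ)
      fun h => ENNReal.ofReal (scanPotential k a b x p κ G (ofResponses a b h)) := by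
  intro h i hA
  obtain ⟨hc, hi⟩ := thresholdScan_eq_inl hA
  have hw := walk_ofResponses_mem ha hb h
  simp only [ofResponses_append]
  have hnn := fun s => scanPotential_nonneg (k := k) (a := a) (b := b) (x := x) hG0 hp0 hp1 hκ s
  have hq0 : 0 ≤ 1 - (p : ℝ) := by linarith
  rw [← ENNReal.ofReal_mul hp0.le, ← ENNReal.ofReal_mul hq0,
    ← ENNReal.ofReal_add (mul_nonneg hp0.le (hnn _)) (mul_nonneg hq0 (hnn _)),
    ← ENNReal.ofReal_add hκ (add_nonneg (mul_nonneg hp0.le (hnn _)) (mul_nonneg hq0 (hnn _)))]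
  refine ENNReal.ofReal_le_ofReal ?_
  generalize ofResponses a b h = s at hc hi hw
  obtain ⟨j, c, u⟩ := s
  simp only at hc hi hw
  subst hi
  have hval : scanPotential k a b x p κ G ⟨i, c, u⟩ =
      walkPotential p κ a b (x i) (G (i + 1) c) (G (i + 1) (c + 1)) u := by
    simp [scanPotential, hc]
  have h1 := hG.scanPotential_next_true_le hp0 hp1 hκ i (u := u) hc
  have h0 := hG.scanPotential_next_false_le hp0 hp1 hκ i (u := u) hc
  have hstep := walkPotential_step (κ := κ) (y := x i) (F₀ := G (i + 1) c)
    (F₁ := G (i + 1) (c + 1)) hp1 hw.1 hw.2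
  rw [hval, ← hstep]
  cases hx : x i <;> rw [hx] at h0 h1 <;>
    simp only [Bool.not_true, Bool.not_false, Bool.false_eq_true, if_true, if_false] <;> gcongr

/-! ### Cost and error bounds -/

/-- The number of `true` bits from position `i` on. -/
def onesFrom {n : ℕ} (x : Fin n → Bool) (i : ℕ) : ℕ :=
  ∑ j ∈ Finset.univ.filter (fun j : Fin n => i ≤ (j : ℕ)), (x j).toNat

lemma onesFrom_zero {n : ℕ} (x : Fin n → Bool) : onesFrom x 0 = ∑ j, (x j).toNat := by
  simp [onesFrom]

lemma onesFrom_of_le {n : ℕ} (x : Fin n → Bool) {i : ℕ} (hi : n ≤ i) : onesFrom x i = 0 := by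
  unfold onesFrom
  refine Finset.sum_eq_zero fun j hj => ?_
  have := (Finset.mem_filter.1 hj).2
  omega

lemma onesFrom_eq_add {n : ℕ} (x : Fin n → Bool) (i : Fin n) :
    onesFrom x i = (x i).toNat + onesFrom x (i + 1) := by
  have : (Finset.univ.filter fun j : Fin n => (i : ℕ) ≤ j) =
      insert i (Finset.univ.filter fun j : Fin n => (i : ℕ) + 1 ≤ j) := by
    ext j
    simp only [Finset.mem_filter, Finset.mem_univ, true_and, Finset.mem_insert, Fin.ext_iff]
    omega
  unfold onesFrom
  rw [this, Finset.sum_insert (by simp)]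

section bounds

variable {n k a b : ℕ} {x : Fin n → Bool} {p : unitInterval}

lemma walkPotential_start_false (p κ : ℝ) (a b : ℕ) (F₀ F₁ : ℝ) :
    walkPotential p κ a b false F₀ F₁ a =
      κ * a / (1 - 2 * p) + F₀ + (p / (1 - p)) ^ b * max (F₁ - F₀) 0 := by
  simp [walkPotential]

lemma walkPotential_start_true (p κ : ℝ) (a b : ℕ) (F₀ F₁ : ℝ) :
    walkPotential p κ a b true F₀ F₁ a =
      κ * b / (1 - 2 * p) + F₁ + (p / (1 - p)) ^ a * max (F₀ - F₁) 0 := by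
  simp [walkPotential]

lemma cast_tsub_eq_add_one {m i : ℕ} (h : i < m) :
    ((m - i : ℕ) : ℝ) = ((m - (i + 1) : ℕ) : ℝ) + 1 := by
  have : m - i = m - (i + 1) + 1 := by omega
  exact_mod_cast this

lemma expectedQueries_thresholdScan_le (hp0 : 0 < (p : ℝ)) (hp1 : (p : ℝ) < 1 / 2)
    (ha : 1 ≤ a) (hb : 1 ≤ b) (hq : ((p : ℝ) / (1 - p)) ^ a ≤ 1 / 2) :
    (thresholdScan n k a b).expectedQueries p x ≤
      ENNReal.ofReal ((n * a + 2 * k * b) / (1 - 2 * p)) := by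
  have h2 : 0 < 1 - 2 * (p : ℝ) := by linarith
  have h3 : 0 < 1 - (p : ℝ) := by linarith
  -- Each remaining bit is charged a short test, each missing declaration two long ones: a one is
  -- missed with probability at most `1 / 2`. Wrongly declaring a one only lowers `G`.
  let G : ℕ → ℕ → ℝ := fun i c =>
    ((n - i : ℕ) : ℝ) * (a / (1 - 2 * p)) + 2 * ((k - c : ℕ) : ℝ) * (b / (1 - 2 * p))
  have hG0 : ∀ i c, 0 ≤ G i c := fun i c => by simp only [G]; positivity
  have hA : 0 ≤ (a : ℝ) / (1 - 2 * p) := by positivity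
  have hB : 0 ≤ (b : ℝ) / (1 - 2 * p) := by positivity
  have hG : DominatesTests k a b x p 1 G := by
    intro i c hc
    have e1 := cast_tsub_eq_add_one i.2
    have e2 := cast_tsub_eq_add_one hc
    rcases hx : x i with _ | _
    · rw [walkPotential_start_false, max_eq_right (by simp only [G]; rw [e2]; nlinarith)]
      simp only [G]
      rw [e1]
      apply le_of_eq
      ring
    · have hd : G (i + 1) c - G (i + 1) (c + 1) = 2 * (b / (1 - 2 * p)) := by
        simp only [G]; rw [e2]; ring
      rw [walkPotential_start_true, hd, max_eq_left (by positivity)]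
      simp only [G]
      rw [e1, e2, one_mul]
      nlinarith [mul_le_mul_of_nonneg_right hq hB]
  have hpot := hG.isPotential hG0 hp0 hp1 zero_le_one ha hb
  rw [ENNReal.ofReal_one] at hpot
  refine hpot.expectedQueries_le.trans (ENNReal.ofReal_le_ofReal ?_)
  refine (hG.scanPotential_le 0 0).trans (le_of_eq ?_)
  simp only [G, Nat.sub_zero]
  ring

lemma measure_returns_false_thresholdScan_le (hp0 : 0 < (p : ℝ)) (hp1 : (p : ℝ) < 1 / 2)
    (ha : 1 ≤ a) (hb : 1 ≤ b) (hq : ((p : ℝ) / (1 - p)) ^ a ≤ 1 / 2)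
    (hx : k ≤ ∑ i, (x i).toNat) :
    noiseMeasure p {ω | (thresholdScan n k a b).Returns x ω false} ≤
      ENNReal.ofReal (2 * k * ((p : ℝ) / (1 - p)) ^ a) := by
  have h3 : 0 < 1 - (p : ℝ) := by linarith
  set q : ℝ := ((p : ℝ) / (1 - p)) ^ a with hqdef
  have hq0 : 0 ≤ q := by positivity
  -- The truncated difference is the deficit that the remaining ones cannot cover, zero at the
  -- start. A miss raises it by at most `1`; the budget `2q` per missing declaration pays for this,
  -- as `q (2q + 1) ≤ 2q`.
  let G : ℕ → ℕ → ℝ := fun i c =>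
    2 * q * ((k - c : ℕ) : ℝ) + ((k - c - onesFrom x i : ℕ) : ℝ)
  have hG0 : ∀ i c, 0 ≤ G i c := fun i c => by simp only [G]; positivity
  have hG : DominatesTests k a b x p 0 G := by
    intro i c hc
    have e1 := onesFrom_eq_add x i
    have e2 := cast_tsub_eq_add_one hc
    rcases hxi : x i with _ | _ <;> rw [hxi] at e1
    · simp only [Bool.toNat_false, zero_add] at e1
      have hm : ((k - (c + 1) - onesFrom x (i + 1) : ℕ) : ℝ) ≤
          ((k - c - onesFrom x (i + 1) : ℕ) : ℝ) := by
        exact_mod_cast (by omega)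
      rw [walkPotential_start_false, max_eq_right (by simp only [G]; rw [e2]; nlinarith)]
      simp [G, e1]
    · simp only [Bool.toNat_true] at e1
      have hm : ((k - c - onesFrom x (i + 1) : ℕ) : ℝ) ≤
          ((k - (c + 1) - onesFrom x (i + 1) : ℕ) : ℝ) + 1 := by
        exact_mod_cast (by omega)
      have hm' : k - c - onesFrom x i = k - (c + 1) - onesFrom x (i + 1) := by omega
      have hd : max (G (i + 1) c - G (i + 1) (c + 1)) 0 ≤ 2 * q + 1 := by
        refine max_le ?_ (by positivity)
        simp only [G]; rw [e2]; linarith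
      rw [walkPotential_start_true, ← hqdef]
      have h4 := mul_le_mul_of_nonneg_left hd hq0
      have h5 : q * (2 * q + 1) ≤ 2 * q := by nlinarith
      have h6 : G i c = G (i + 1) (c + 1) + 2 * q := by
        simp only [G]; rw [e2, hm']; ring
      rw [h6]
      simp only [zero_mul, zero_div, zero_add]
      linarith
  have hpot := hG.isPotential hG0 hp0 hp1 le_rfl ha hb
  rw [ENNReal.ofReal_zero] at hpot
  refine (hpot.measure_returns_le fun h hh => ?_).trans (ENNReal.ofReal_le_ofReal ?_)
  · obtain ⟨h1, h2⟩ := thresholdScan_eq_inr_false hh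
    rw [ENNReal.one_le_ofReal, scanPotential, dif_neg (by omega)]
    simp only [G, onesFrom_of_le x h2, Nat.sub_zero]
    have h4 : (1 : ℝ) ≤ ((k - (ofResponses a b h).count : ℕ) : ℝ) := by exact_mod_cast (by omega)
    have h5 : 0 ≤ 2 * q * ((k - (ofResponses a b h).count : ℕ) : ℝ) := by positivity
    linarith
  · refine (hG.scanPotential_le 0 0).trans (le_of_eq ?_)
    simp only [G, onesFrom_zero, Nat.sub_zero, Nat.sub_eq_zero_of_le hx]
    push_cast
    ring

lemma measure_returns_true_thresholdScan_le (hp0 : 0 < (p : ℝ)) (hp1 : (p : ℝ) < 1 / 2)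
    (ha : 1 ≤ a) (hb : 1 ≤ b) (hx : ∑ i, (x i).toNat < k) :
    noiseMeasure p {ω | (thresholdScan n k a b).Returns x ω true} ≤
      ENNReal.ofReal (n * ((p : ℝ) / (1 - p)) ^ b) := by
  have h3 : 0 < 1 - (p : ℝ) := by linarith
  set q : ℝ := ((p : ℝ) / (1 - p)) ^ b with hqdef
  have hq0 : 0 ≤ q := by positivity
  -- The second term is zero while declared plus remaining ones stay below `k`; the `+ 1` makes it
  -- at least `1` once `c = k`. A false alarm raises it by at most `1`, paid by `q` per bit.
  let G : ℕ → ℕ → ℝ := fun i c =>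
    q * ((n - i : ℕ) : ℝ) + ((c + onesFrom x i + 1 - k : ℕ) : ℝ)
  have hG0 : ∀ i c, 0 ≤ G i c := fun i c => by simp only [G]; positivity
  have hG : DominatesTests k a b x p 0 G := by
    intro i c hc
    have e1 := onesFrom_eq_add x i
    have e2 := cast_tsub_eq_add_one i.2
    rcases hxi : x i with _ | _ <;> rw [hxi] at e1
    · simp only [Bool.toNat_false, zero_add] at e1
      have hm : ((c + 1 + onesFrom x (i + 1) + 1 - k : ℕ) : ℝ) ≤
          ((c + onesFrom x (i + 1) + 1 - k : ℕ) : ℝ) + 1 := by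
        exact_mod_cast (by omega)
      have hd : max (G (i + 1) (c + 1) - G (i + 1) c) 0 ≤ 1 := by
        refine max_le ?_ zero_le_one
        simp only [G]; linarith
      rw [walkPotential_start_false, ← hqdef]
      have h4 := mul_le_mul_of_nonneg_left hd hq0
      have h6 : G i c = G (i + 1) c + q := by
        simp only [G]; rw [e2, e1]; ring
      rw [h6]
      simp only [zero_mul, zero_div, zero_add]
      linarith
    · simp only [Bool.toNat_true] at e1
      have hm : ((c + onesFrom x (i + 1) + 1 - k : ℕ) : ℝ) ≤
          ((c + 1 + onesFrom x (i + 1) + 1 - k : ℕ) : ℝ) := by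
        exact_mod_cast (by omega)
      have hm' : c + onesFrom x i + 1 - k = c + 1 + onesFrom x (i + 1) + 1 - k := by omega
      rw [walkPotential_start_true, max_eq_right (by simp only [G]; linarith)]
      simp only [G, zero_mul, zero_div, zero_add, mul_zero, add_zero]
      rw [e2, hm']
      linarith
  have hpot := hG.isPotential hG0 hp0 hp1 le_rfl ha hb
  rw [ENNReal.ofReal_zero] at hpot
  refine (hpot.measure_returns_le fun h hh => ?_).trans (ENNReal.ofReal_le_ofReal ?_)
  · have h1 := thresholdScan_eq_inr_true hh
    rw [ENNReal.one_le_ofReal, scanPotential, dif_neg (by omega)]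
    simp only [G]
    have h4 : (1 : ℝ) ≤ (((ofResponses a b h).count + onesFrom x (ofResponses a b h).bit + 1 - k
      : ℕ) : ℝ) := by exact_mod_cast (by omega)
    have h5 : 0 ≤ q * ((n - (ofResponses a b h).bit : ℕ) : ℝ) := by positivity
    linarith
  · refine (hG.scanPotential_le 0 0).trans (le_of_eq ?_)
    have : 0 + onesFrom x 0 + 1 - k = 0 := by rw [onesFrom_zero]; omega
    simp only [G, this, Nat.sub_zero]
    push_cast
    ring

lemma worstCaseError_thresholdScan_le (hp0 : 0 < (p : ℝ)) (hp1 : (p : ℝ) < 1 / 2)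
    (ha : 1 ≤ a) (hb : 1 ≤ b) (hq : ((p : ℝ) / (1 - p)) ^ a ≤ 1 / 2) {δ : ℝ}
    (hδa : 2 * k * ((p : ℝ) / (1 - p)) ^ a ≤ δ) (hδb : n * ((p : ℝ) / (1 - p)) ^ b ≤ δ) :
    (thresholdScan n k a b).worstCaseError p (threshold k) ≤ ENNReal.ofReal δ := by
  refine iSup_le fun x => ?_
  have hfin : (thresholdScan n k a b).expectedQueries p x ≠ ∞ :=
    ne_top_of_le_ne_top ENNReal.ofReal_ne_top (expectedQueries_thresholdScan_le hp0 hp1 ha hb hq)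
  refine (QueryAlgorithm.measure_not_returns_le hfin _).trans ?_
  by_cases hx : k ≤ ∑ i, (x i).toNat
  · simp only [threshold, hx, decide_true, Bool.not_true]
    exact (measure_returns_false_thresholdScan_le hp0 hp1 ha hb hq hx).trans
      (ENNReal.ofReal_le_ofReal hδa)
  · simp only [threshold, hx, decide_false, Bool.not_false]
    exact (measure_returns_true_thresholdScan_le hp0 hp1 ha hb (not_le.1 hx)).trans
      (ENNReal.ofReal_le_ofReal hδb)

end bounds

/-! ### Choice of the barriers and asymptotics -/

/-- A test length which guarantees an error probability of at most `1 / y`. -/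
noncomputable def testLength (p y : ℝ) : ℕ :=
  ⌈Real.log y / Real.log ((1 - p) / p)⌉₊ + 1

section testLength

variable {p y : ℝ}

lemma log_odds_pos (hp0 : 0 < p) (hp1 : p < 1 / 2) : 0 < Real.log ((1 - p) / p) := by
  refine Real.log_pos ?_
  rw [one_lt_div hp0]
  linarith

lemma one_le_testLength (p y : ℝ) : 1 ≤ testLength p y := by simp [testLength]

lemma pow_testLength_le (hp0 : 0 < p) (hp1 : p < 1 / 2) (hy : 0 < y) :
    (p / (1 - p)) ^ testLength p y ≤ y⁻¹ := by
  have hlam := log_odds_pos hp0 hp1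
  have h3 : 0 < 1 - p := by linarith
  have h1 : Real.log y ≤ testLength p y * Real.log ((1 - p) / p) := by
    rw [← div_le_iff₀ hlam]
    refine (Nat.le_ceil _).trans ?_
    simp [testLength]
  rw [← Real.log_le_log_iff (by positivity) (by positivity), Real.log_pow, Real.log_inv,
    ← inv_div, Real.log_inv]
  linarith

lemma testLength_mul_le (hp0 : 0 < p) (hp1 : p < 1 / 2) (hy : 1 ≤ y) :
    testLength p y * Real.log ((1 - p) / p) ≤ Real.log y + 2 * Real.log ((1 - p) / p) := by
  have hlam := log_odds_pos hp0 hp1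
  have h1 := (Nat.ceil_lt_add_one (div_nonneg (Real.log_nonneg hy) hlam.le)).le
  have h2 : (testLength p y : ℝ) ≤ Real.log y / Real.log ((1 - p) / p) + 2 := by
    simp only [testLength]; push_cast; linarith
  calc _ ≤ (Real.log y / Real.log ((1 - p) / p) + 2) * Real.log ((1 - p) / p) := by gcongr
    _ = _ := by field_simp

end testLength

/-- The relative excess of the expected number of queries of the sequential scan over
`n log (k / δ) / D`. -/
noncomputable def scanExcess (p n k δ : ℝ) : ℝ :=
  (Real.log 2 + 2 * Real.log ((1 - p) / p)) / Real.log (k / δ) +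
    2 * Real.negMulLog (k / n) / Real.log (k / δ) + 2 * (k / n) +
      4 * Real.log ((1 - p) / p) * (k / n) / Real.log (k / δ)

/-- Since `k ≥ 1`, `log (k/δ) ≥ log (1/δ) → ∞`; and `(k/n) log (n/k) → 0` by continuity of
`Real.negMulLog` at `0`. -/
lemma tendsto_scanExcess (p : ℝ) {k : ℕ → ℕ} (hk1 : ∀ n, 1 ≤ k n)
    (hk : (fun n => (k n : ℝ)) =o[atTop] (fun n => (n : ℝ)))
    {δ : ℕ → ℝ} (hδ0 : ∀ n, 0 < δ n) (hδ : Tendsto δ atTop (𝓝 0)) :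
    Tendsto (fun n : ℕ => scanExcess p n (k n) (δ n)) atTop (𝓝 0) := by
  have hratio : Tendsto (fun n : ℕ => (k n : ℝ) / n) atTop (𝓝 0) := hk.tendsto_div_nhds_zero
  have hlog : Tendsto (fun n : ℕ => Real.log (k n / δ n)) atTop atTop := by
    have h1 : Tendsto δ atTop (𝓝[>] 0) :=
      tendsto_nhdsWithin_iff.2 ⟨hδ, Eventually.of_forall hδ0⟩
    refine tendsto_atTop_mono (fun n => ?_)
      (tendsto_neg_atBot_atTop.comp (Real.tendsto_log_nhdsGT_zero.comp h1))
    have h2 : (1 : ℝ) ≤ k n := by exact_mod_cast hk1 n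
    simp only [Function.comp_apply]
    rw [Real.log_div (by positivity) (hδ0 n).ne']
    linarith [Real.log_nonneg h2]
  have hneg : Tendsto (fun n : ℕ => Real.negMulLog (k n / n)) atTop (𝓝 0) := by
    have := (Real.continuous_negMulLog.tendsto 0).comp hratio
    simpa [Function.comp_def] using this
  have t1 : Tendsto (fun n : ℕ => (Real.log 2 + 2 * Real.log ((1 - p) / p)) /
      Real.log (k n / δ n)) atTop (𝓝 0) := tendsto_const_nhds.div_atTop hlog
  have t2 := (hneg.const_mul 2).div_atTop hlog
  have t3 := hratio.const_mul 2
  have t4 := (hratio.const_mul (4 * Real.log ((1 - p) / p))).div_atTop hlog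
  simpa [scanExcess] using ((t1.add t2).add t3).add t4

lemma scan_cost_le {p δ : ℝ} (hp0 : 0 < p) (hp1 : p < 1 / 2) {n k : ℕ} (hn : 1 ≤ n) (hk : 1 ≤ k)
    (hδ0 : 0 < δ) (hδ1 : δ < 1) :
    (n * testLength p (2 * k / δ) + 2 * k * testLength p (n / δ)) / (1 - 2 * p) ≤
      (1 + scanExcess p n k δ) *
        (n * Real.log (k / δ) / ((1 - 2 * p) * Real.log ((1 - p) / p))) := by
  have hlam := log_odds_pos hp0 hp1
  have h2 : 0 < 1 - 2 * p := by linarith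
  have hn' : (1 : ℝ) ≤ n := by exact_mod_cast hn
  have hk' : (1 : ℝ) ≤ k := by exact_mod_cast hk
  have hn0 : (0 : ℝ) < n := by linarith
  have hk0 : (0 : ℝ) < k := by linarith
  have hkδ : 1 < k / δ := by rw [one_lt_div hδ0]; linarith
  have hL : 0 < Real.log (k / δ) := Real.log_pos hkδ
  have ha := testLength_mul_le hp0 hp1 (y := 2 * k / δ) (by rw [mul_div_assoc]; linarith)
  have hb := testLength_mul_le hp0 hp1 (y := n / δ) (by rw [one_le_div hδ0]; linarith)
  have e1 : Real.log (2 * k / δ) = Real.log 2 + Real.log (k / δ) := by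
    rw [mul_div_assoc, Real.log_mul (by norm_num) (by positivity)]
  have e2 : Real.log (n / δ) = Real.log (k / δ) - Real.log (k / n) := by
    rw [Real.log_div hn0.ne' hδ0.ne', Real.log_div hk0.ne' hδ0.ne', Real.log_div hk0.ne' hn0.ne']
    ring
  rw [e1] at ha
  rw [e2] at hb
  -- `scanExcess` is made for this identity: `log 2` comes from `2k/δ`, the `negMulLog` term from
  -- `log (n/δ) = log (k/δ) + log (n/k)`.
  have hrhs : (1 + scanExcess p n k δ) *
      (n * Real.log (k / δ) / ((1 - 2 * p) * Real.log ((1 - p) / p))) =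
      (n * (Real.log 2 + Real.log (k / δ) + 2 * Real.log ((1 - p) / p)) +
        2 * k * (Real.log (k / δ) - Real.log (k / n) + 2 * Real.log ((1 - p) / p))) /
        ((1 - 2 * p) * Real.log ((1 - p) / p)) := by
    simp only [scanExcess, Real.negMulLog]
    generalize Real.log (k / δ) = L at *
    generalize Real.log (k / n) = R at *
    generalize Real.log ((1 - p) / p) = l at *
    generalize Real.log 2 = t at *
    field_simp
    ring
  rw [hrhs, ← div_div, div_right_comm]
  refine div_le_div_of_nonneg_right ?_ h2.le
  rw [le_div_iff₀ hlam]
  have ha' := mul_le_mul_of_nonneg_left ha hn0.le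
  have hb' := mul_le_mul_of_nonneg_left hb (show (0 : ℝ) ≤ 2 * k by positivity)
  linarith

section constant

variable {n : ℕ} {p : unitInterval}

lemma expectedQueries_const (b : Bool) (x : Fin n → Bool) :
    QueryAlgorithm.expectedQueries (fun _ => Sum.inr b : QueryAlgorithm n) p x = 0 := by
  simp [QueryAlgorithm.expectedQueries, QueryAlgorithm.numQueries]

lemma worstCaseError_le_one (A : QueryAlgorithm n) (f : (Fin n → Bool) → Bool) :
    A.worstCaseError p f ≤ 1 :=
  iSup_le fun _ => prob_le_one

lemma worstCaseError_const_of_forall_eq {b : Bool} {f : (Fin n → Bool) → Bool}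
    (hf : ∀ x, f x = b) :
    QueryAlgorithm.worstCaseError (fun _ => Sum.inr b : QueryAlgorithm n) p f = 0 := by
  simp [QueryAlgorithm.worstCaseError, QueryAlgorithm.Returns, hf]

end constant

theorem theorem2 (p : unitInterval) (hp0 : 0 < (p : ℝ)) (hp1 : (p : ℝ) < 1 / 2)
    (k : ℕ → ℕ) (hk1 : ∀ n, 1 ≤ k n)
    (hk : (fun n => (k n : ℝ)) =o[atTop] (fun n => (n : ℝ)))
    (δ : ℕ → ℝ) (hδ0 : ∀ n, 0 < δ n)
    (hδ : δ =o[atTop] (fun _ => (1 : ℝ))) :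
    ∃ (A : ∀ n : ℕ, QueryAlgorithm n) (ε : ℕ → ℝ),
      ε =o[atTop] (fun _ => (1 : ℝ)) ∧
      ∀ n : ℕ,
        (A n).worstCaseError p (threshold (k n)) ≤ ENNReal.ofReal (δ n) ∧
        ∀ x : Fin n → Bool,
          (A n).expectedQueries p x ≤
            ENNReal.ofReal ((1 + ε n) *
              ((n : ℝ) * Real.log ((k n : ℝ) / δ n) /
                klBernoulli p (unitInterval.symm p))) := by
  have hδ' : Tendsto δ atTop (𝓝 0) := (isLittleO_one_iff ℝ).1 hδ
  -- Otherwise no query is needed: if `δ n ≥ 1` any error is allowed, and if `n = 0` the answer is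
  -- `false` as `k ≥ 1`. Zero queries satisfy the bound whatever the sign of its right side.
  refine ⟨fun n => if 1 ≤ n ∧ δ n < 1 then
      thresholdScan n (k n) (testLength p (2 * k n / δ n)) (testLength p (n / δ n))
    else fun _ => Sum.inr false, fun n => scanExcess p n (k n) (δ n),
    (isLittleO_one_iff ℝ).2 (tendsto_scanExcess p hk1 hk hδ0 hδ'), fun n => ?_⟩
  have hδn := hδ0 n
  by_cases h : 1 ≤ n ∧ δ n < 1
  · simp only [if_pos h]
    have hn0 : (0 : ℝ) < n := by exact_mod_cast h.1
    have hk' : (1 : ℝ) ≤ k n := by exact_mod_cast hk1 n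
    have hk0 : (0 : ℝ) < k n := by linarith
    have h1 := pow_testLength_le hp0 hp1 (y := 2 * k n / δ n) (by positivity)
    have h2 := pow_testLength_le hp0 hp1 (y := n / δ n) (by positivity)
    rw [inv_div] at h1 h2
    have hq := h1.trans (show δ n / (2 * k n) ≤ 1 / 2 by
      rw [div_le_div_iff₀ (by positivity) (by norm_num)]; linarith [h.2])
    rw [le_div_iff₀' (by positivity)] at h1 h2
    refine ⟨worstCaseError_thresholdScan_le hp0 hp1 (one_le_testLength _ _)
      (one_le_testLength _ _) hq h1 h2, fun x => ?_⟩
    refine (expectedQueries_thresholdScan_le hp0 hp1 (one_le_testLength _ _)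
      (one_le_testLength _ _) hq).trans (ENNReal.ofReal_le_ofReal ?_)
    rw [klBernoulli_symm_eq hp0 hp1]
    exact scan_cost_le hp0 hp1 h.1 (hk1 n) hδn h.2
  · simp only [if_neg h, expectedQueries_const, zero_le, implies_true, and_true]
    rcases not_and_or.1 h with h0 | h1
    · obtain rfl : n = 0 := by omega
      rw [worstCaseError_const_of_forall_eq]
      · exact zero_le
      · intro x
        have := hk1 0
        simp [threshold]
        omega
    · exact (worstCaseError_le_one _ _).trans (ENNReal.one_le_ofReal.2 (not_lt.1 h1))
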